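/- Let $\mathcal X$ be an instance space, $\mathcal Y=\{\pm1\}$, $\mathcal H\subseteq\mathcal Y^{\mathcal X}$ a nonempty hypothesis class and $\mathcal T$ a nonempty collection of maps $T:\mathcal X\to\mathcal X$. Put $\mathcal H\circ\mathcal T=\{h\circ T: h\in\mathcal H,\ T\in\mathcal T\}$ and let $\mathrm{vc}(\mathcal H\circ\mathcal T)$ be its VC dimension, assumed finite. For a distribution $\mathcal D$ on $\mathcal X\times\mathcal Y$ let $\mathrm{err}(h,T(\mathcal D))=\Pr_{(x,y)\sim\mathcal D}[h(T(x))\ne y]$ and $\mathsf{OPT}_T=\inf_{h\in\mathcal H}\mathrm{err}(h,T(\mathcal D))$. For a sample $S=((x_1,y_1),\dots,(x_m,y_m))$ let $\mathrm{err}(h,T(S))=\frac1m\sum_{i=1}^m\mathbf 1[h(T(x_i))\ne y_i]$ and $\widehat{\mathsf{OPT}}_T=\inf_{h\in\mathcal H}\mathrm{err}(h,T(S))$. Consider the learning rule $$\hat h\in\operatorname*{argmin}_{h\in\mathcal H}\ \max_{T\in\mathcal T}\bigl\{\mathrm{err}(h,T(S))-\widehat{\mathsf{OPT}}_T\bigr\}.$$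 There is a universal constant $C>0$ such that for all such $\mathcal X,\mathcal H,\mathcal T$, all $\varepsilon,\delta\in(0,\tfrac12)$, every distribution $\mathcal D$ on $\mathcal X\times\mathcal Y$ and every $m\ge C\,\frac{\mathrm{vc}(\mathcal H\circ\mathcal T)+\log(1/\delta)}{\varepsilon^2}$, the following holds with probability at least $1-\delta$ over $S\sim\mathcal D^m$ (that is, outside a set of outer probability at most $\delta$), for every $\hat h$ that the rule may output on $S$: $$\sup_{T\in\mathcal T}\bigl\{\mathrm{err}(\hat h,T(\mathcal D))-\mathsf{OPT}_T\bigr\}\ \le\ \inf_{h^\star\in\mathcal H}\ \sup_{T\in\mathcal T}\bigl\{\mathrm{err}(h^\star,T(\mathcal D))-\mathsf{OPT}_T\bigr\}+\varepsilon .$$ Here the usual measurability convention of VC theory is in force: every member of $\mathcal H\circ\mathcal T$ is measurable, and the function $(S,S')\mapsto\sup_{h\in\mathcal H,\,T\in\mathcal T}|\mathrm{err}(h,T(S))-\mathrm{err}(h,T(S'))|$ of two samples of size $m$ is measurable up to $\mathcal D^m\otimes\mathcal D^m$-null sets (automatic from the first condition if $\mathcal H\circ\mathcal T$ is countable). -/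

import Mathlib

open MeasureTheory

universe u

noncomputable section

namespace TransformationLearning

/-- The label space `{±1}`: the units of `ℤ` are exactly `1` and `-1`. -/
abbrev Label : Type := ℤˣ

/-- The `σ`-algebra that Mathlib puts on the two-point space `ℤˣ` is the discrete one. -/
instance : DiscreteMeasurableSpace Label :=
  ⟨fun s => ⟨(fun y : ℤˣ => (y : ℤ)) '' s, trivial, Set.preimage_image_eq s Units.val_injective⟩⟩

/-- The composition `H ∘ 𝒯 = {h ∘ T : h ∈ H, T ∈ 𝒯}`. -/
def compClass {X : Type u} (H : Set (X → Label)) (𝒯 : Set (X → X)) : Set (X → Label) :=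
  {f | ∃ h ∈ H, ∃ T ∈ 𝒯, f = h ∘ T}

/-- A class `F` shatters a finite set `A` if every labelling of `A` is realized by `F`. -/
def Shatters {X : Type u} (F : Set (X → Label)) (A : Finset X) : Prop :=
  ∀ g : X → Label, ∃ f ∈ F, ∀ x ∈ A, f x = g x

/-- The VC dimension: the supremum (possibly infinite) of the sizes of shattered sets. -/
def vcDim {X : Type u} (F : Set (X → Label)) : ℕ∞ :=
  ⨆ (A : Finset X) (_ : Shatters F A), (A.card : ℕ∞)

/-- Population error `err(f, D) = P_{(x,y) ∼ D}[f x ≠ y]`. -/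
def err {X : Type u} [MeasurableSpace X] (D : Measure (X × Label)) (f : X → Label) : ℝ :=
  D.real {p | f p.1 ≠ p.2}

/-- Empirical error of `f` on the sample `S`. -/
def empErr {X : Type u} {m : ℕ} (S : Fin m → X × Label) (f : X → Label) : ℝ :=
  (1 / (m : ℝ)) * ∑ i, if f (S i).1 ≠ (S i).2 then (1 : ℝ) else 0

/-- `OPT_T = inf_{h ∈ H} err(h, T(D))`, where `err(h, T(D)) = P_{(x,y) ∼ D}[h (T x) ≠ y]`. -/
def opt {X : Type u} [MeasurableSpace X] (D : Measure (X × Label)) (H : Set (X → Label))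
    (T : X → X) : ℝ :=
  ⨅ h : H, err D ((h : X → Label) ∘ T)

/-- The empirical counterpart of `opt`: the best empirical error on `T(S)` within `H`. -/
def empOpt {X : Type u} {m : ℕ} (S : Fin m → X × Label) (H : Set (X → Label))
    (T : X → X) : ℝ :=
  ⨅ h : H, empErr S ((h : X → Label) ∘ T)

/-- Worst-case regret `sup_{T ∈ 𝒯} (err(h, T(D)) - OPT_T)`. -/
def worstRegret {X : Type u} [MeasurableSpace X] (D : Measure (X × Label))
    (H : Set (X → Label)) (𝒯 : Set (X → X)) (h : X → Label) : ℝ :=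
  ⨆ T : 𝒯, (err D (h ∘ (T : X → X)) - opt D H T)

/-- Empirical worst-case regret of `h` on the sample `S`. -/
def empWorstRegret {X : Type u} {m : ℕ} (S : Fin m → X × Label)
    (H : Set (X → Label)) (𝒯 : Set (X → X)) (h : X → Label) : ℝ :=
  ⨆ T : 𝒯, (empErr S (h ∘ (T : X → X)) - empOpt S H T)

/-- `h` is an output of the learning rule on `S`: a minimizer over `H` of the empirical
worst-case regret. -/
def IsRegretMinimizer {X : Type u} {m : ℕ} (S : Fin m → X × Label)
    (H : Set (X → Label)) (𝒯 : Set (X → X)) (h : X → Label) : Prop :=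
  h ∈ H ∧ ∀ h' ∈ H, empWorstRegret S H 𝒯 h ≤ empWorstRegret S H 𝒯 h'

/-- The law `D^m` of an i.i.d. sample of size `m`. -/
def sampleLaw {X : Type u} [MeasurableSpace X] (D : Measure (X × Label)) (m : ℕ) :
    Measure (Fin m → X × Label) :=
  Measure.pi fun _ => D

/-- The usual measurability convention for a possibly uncountable class `F`, at sample size `m`:
each member is measurable, and so is the largest discrepancy over `F` between the empirical errors
on two independent samples of size `m` (up to null sets). The second part is automatic for
countable `F`. Only measurability is required, not any bound. -/
structure WellBehaved {X : Type u} [MeasurableSpace X] (D : Measure (X × Label))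
    (F : Set (X → Label)) (m : ℕ) : Prop where
  measurable : ∀ f ∈ F, Measurable f
  aemeasurable_discrepancy :
    AEMeasurable
      (fun p : (Fin m → X × Label) × (Fin m → X × Label) =>
        ⨆ f : F, |empErr p.1 (f : X → Label) - empErr p.2 (f : X → Label)|)
      ((sampleLaw D m).prod (sampleLaw D m))

end TransformationLearning

end

open TransformationLearning

namespace TransformationLearning

/-- The sign in `{±1} ⊆ ℝ` encoded by a Boolean. -/
def boolSign (b : Bool) : ℝ := if b then 1 else -1

/-! ### Rademacher tails and packing numbers of finite VC families. -/

section Combinatorics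

open Finset

theorem sum_exp_rademacher_le {ι : Type*} [Fintype ι] [DecidableEq ι] (a : ι → ℝ) (l : ℝ) :
    ∑ σ : ι → Bool, Real.exp (l * ∑ i, boolSign (σ i) * a i)
      ≤ 2 ^ Fintype.card ι * Real.exp (l ^ 2 * (∑ i, a i ^ 2) / 2) := by
  have h1 : ∑ σ : ι → Bool, Real.exp (l * ∑ i, boolSign (σ i) * a i)
      = ∏ i, ∑ b : Bool, Real.exp (l * (boolSign b * a i)) := by
    rw [Finset.prod_univ_sum, Fintype.piFinset_univ]
    refine Finset.sum_congr rfl fun σ _ => ?_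
    rw [Finset.mul_sum, Real.exp_sum]
  have h2 : ∀ i, ∑ b : Bool, Real.exp (l * (boolSign b * a i))
      ≤ 2 * Real.exp ((l * a i) ^ 2 / 2) := fun i => by
    have := Real.cosh_le_exp_half_sq (l * a i)
    rw [Real.cosh_eq] at this
    simp only [Fintype.sum_bool, boolSign, if_true, Bool.false_eq_true, if_false, one_mul,
      neg_mul, mul_neg]
    linarith
  rw [h1]
  calc ∏ i, ∑ b : Bool, Real.exp (l * (boolSign b * a i))
      ≤ ∏ i, (2 * Real.exp ((l * a i) ^ 2 / 2)) :=
        Finset.prod_le_prod (fun i _ => Finset.sum_nonneg fun _ _ => (Real.exp_pos _).le)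
          fun i _ => h2 i
    _ = _ := by
      rw [Finset.prod_mul_distrib, ← Real.exp_sum, Finset.prod_const, Finset.card_univ,
        Finset.mul_sum, Finset.sum_div]
      simp only [mul_pow]

/-- Chernoff's method; `t / V` minimizes `l ^ 2 * V / 2 - l * t`. -/
theorem card_rademacher_ge_le {ι : Type*} [Fintype ι] [DecidableEq ι] (a : ι → ℝ) {V t : ℝ}
    (hV : 0 < V) (ha : ∑ i, a i ^ 2 ≤ V) (ht : 0 ≤ t) :
    (#{σ : ι → Bool | t ≤ ∑ i, boolSign (σ i) * a i} : ℝ)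
      ≤ 2 ^ Fintype.card ι * Real.exp (-(t ^ 2 / (2 * V))) := by
  have h := sum_exp_rademacher_le a (t / V)
  have h1 : (#{σ : ι → Bool | t ≤ ∑ i, boolSign (σ i) * a i} : ℝ) * Real.exp (t ^ 2 / V)
      ≤ ∑ σ : ι → Bool, Real.exp (t / V * ∑ i, boolSign (σ i) * a i) := by
    rw [← nsmul_eq_mul, ← Finset.sum_const]
    refine (Finset.sum_le_sum fun σ hσ => ?_).trans
      (Finset.sum_le_sum_of_subset_of_nonneg (Finset.filter_subset _ _)
        fun _ _ _ => (Real.exp_pos _).le)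
    rw [Finset.mem_filter] at hσ
    apply Real.exp_le_exp.2
    have : t ^ 2 / V = t / V * t := by ring
    rw [this]
    exact mul_le_mul_of_nonneg_left hσ.2 (by positivity)
  have h2 : Real.exp ((t / V) ^ 2 * (∑ i, a i ^ 2) / 2)
      ≤ Real.exp (-(t ^ 2 / (2 * V))) * Real.exp (t ^ 2 / V) := by
    rw [← Real.exp_add]
    apply Real.exp_le_exp.2
    calc (t / V) ^ 2 * (∑ i, a i ^ 2) / 2 ≤ (t / V) ^ 2 * V / 2 := by gcongr
      _ = _ := by field_simp; ring
  have h3 := (h1.trans h).trans (mul_le_mul_of_nonneg_left h2 (by positivity))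
  rw [← mul_assoc] at h3
  exact le_of_mul_le_mul_right h3 (Real.exp_pos _)

/-- Hoeffding's inequality for Rademacher sums, in counting form. -/
theorem card_abs_rademacher_ge_le {ι : Type*} [Fintype ι] [DecidableEq ι] (a : ι → ℝ) {V t : ℝ}
    (hV : 0 < V) (ha : ∑ i, a i ^ 2 ≤ V) (ht : 0 ≤ t) :
    (#{σ : ι → Bool | t ≤ |∑ i, boolSign (σ i) * a i|} : ℝ)
      ≤ 2 ^ Fintype.card ι * (2 * Real.exp (-(t ^ 2 / (2 * V)))) := by
  have h1 := card_rademacher_ge_le a hV ha ht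
  have h2 := card_rademacher_ge_le (fun i => -a i) hV (by simpa using ha) ht
  have h3 : (#{σ : ι → Bool | t ≤ |∑ i, boolSign (σ i) * a i|} : ℝ)
      ≤ #{σ : ι → Bool | t ≤ ∑ i, boolSign (σ i) * a i}
        + #{σ : ι → Bool | t ≤ ∑ i, boolSign (σ i) * -a i} := by
    rw [← Nat.cast_add]
    refine Nat.cast_le.2 ((Finset.card_le_card fun σ hσ => ?_).trans (Finset.card_union_le _ _))
    simp only [Finset.mem_filter, Finset.mem_univ, true_and, Finset.mem_union, mul_neg,
      Finset.sum_neg_distrib] at hσ ⊢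
    exact le_abs.1 hσ
  linarith

/-- Weight each `s` by `x ^ #s ≥ x ^ d` and sum to `(1 + x) ^ #R`. The parameter `x` stays free so
that the packing bound can tune it. -/
theorem card_filter_powerset_mul_pow_le {α : Type*} (R : Finset α) (d : ℕ) {x : ℝ}
    (hx0 : 0 < x) (hx1 : x ≤ 1) :
    (#{s ∈ R.powerset | #s ≤ d} : ℝ) * x ^ d ≤ Real.exp (#R * x) := by
  calc (#{s ∈ R.powerset | #s ≤ d} : ℝ) * x ^ d
      = ∑ s ∈ R.powerset with #s ≤ d, x ^ d := by rw [Finset.sum_const, nsmul_eq_mul]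
    _ ≤ ∑ s ∈ R.powerset with #s ≤ d, x ^ #s := Finset.sum_le_sum fun s hs =>
        pow_le_pow_of_le_one hx0.le hx1 (Finset.mem_filter.1 hs).2
    _ ≤ ∑ s ∈ R.powerset, x ^ #s :=
        Finset.sum_le_sum_of_subset_of_nonneg (Finset.filter_subset _ _)
          fun _ _ _ => by positivity
    _ = (x + 1) ^ #R := by
        rw [← Finset.sum_pow_mul_eq_add_pow]; simp
    _ ≤ Real.exp x ^ #R := by
        gcongr; exact Real.add_one_le_exp x
    _ = _ := by rw [← Real.exp_nat_mul]

/-- The Sauer-Shelah lemma for the trace of a set family on a set `R` separating its members. -/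
theorem card_mul_pow_le_of_injOn_inter {α : Type*} [DecidableEq α] {𝒜 : Finset (Finset α)} {d : ℕ}
    (hd : ∀ s, 𝒜.Shatters s → #s ≤ d) {R : Finset α}
    (hR : Set.InjOn (fun A => A ∩ R) (𝒜 : Set (Finset α))) {x : ℝ}
    (hx0 : 0 < x) (hx1 : x ≤ 1) : (#𝒜 : ℝ) * x ^ d ≤ Real.exp (#R * x) := by
  refine le_trans ?_ (card_filter_powerset_mul_pow_le R d hx0 hx1)
  refine mul_le_mul_of_nonneg_right (Nat.cast_le.2 ?_) (by positivity)
  rw [← Finset.card_image_of_injOn hR]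
  -- A family has at most as many members as sets it shatters; a set shattered by the trace lies in
  -- `R` and is shattered by `𝒜` itself.
  refine (Finset.card_le_card_shatterer _).trans (Finset.card_le_card fun s hs => ?_)
  rw [Finset.mem_shatterer] at hs
  have hsR : s ⊆ R := by
    obtain ⟨u, hu, hsu⟩ := hs (Finset.Subset.refl s)
    obtain ⟨A, _, rfl⟩ := Finset.mem_image.1 hu
    exact (Finset.inter_eq_left.1 hsu).trans Finset.inter_subset_right
  rw [Finset.mem_filter, Finset.mem_powerset]
  refine ⟨hsR, hd s fun t ht => ?_⟩
  obtain ⟨u, hu, hsu⟩ := hs ht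
  obtain ⟨A, hA, rfl⟩ := Finset.mem_image.1 hu
  refine ⟨A, hA, ?_⟩
  rw [← hsu, ← Finset.inter_assoc, Finset.inter_eq_left.2 (Finset.inter_subset_left.trans hsR)]

/-- A few points suffice to tell apart the members of a well separated set family. -/
theorem exists_card_le_injOn_inter {α : Type*} [Fintype α] [DecidableEq α]
    (𝒜 : Finset (Finset α)) {a : ℝ} (ha : 1 ≤ a)
    (hsep : ∀ A ∈ 𝒜, ∀ B ∈ 𝒜, A ≠ B → (Fintype.card α : ℝ) ≤ a * #(symmDiff A B))
    {k : ℕ} (hk : (#𝒜 : ℝ) ^ 2 * Real.exp (-(k / a)) < 1) :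
    ∃ R : Finset α, #R ≤ k ∧ Set.InjOn (fun A => A ∩ R) (𝒜 : Set (Finset α)) := by
  by_contra! hcon
  -- Probabilistic method by counting: if no `R` works, every `k`-tuple misses some symmetric
  -- difference, yet a given one is missed by at most a fraction `(1 - 1/a)^k ≤ exp (-k/a)` of the
  -- tuples.
  have hpair : ∀ φ : Fin k → α, ∃ p ∈ 𝒜.offDiag, ∀ i, φ i ∈ (symmDiff p.1 p.2)ᶜ := by
    intro φ
    have h1 := hcon (univ.image φ) (Finset.card_image_le.trans (by simp))
    simp only [Set.InjOn, not_forall] at h1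
    obtain ⟨A, hA, B, hB, hAB, hne⟩ := h1
    refine ⟨(A, B), Finset.mem_offDiag.2 ⟨hA, hB, hne⟩, fun i => ?_⟩
    have h2 := congrArg (φ i ∈ ·) hAB
    simp only [Finset.mem_inter, Finset.mem_image, Finset.mem_univ, true_and,
      exists_apply_eq_apply, and_true, eq_iff_iff] at h2
    simp only [Finset.mem_compl, Finset.mem_symmDiff]
    tauto
  have hpos : 0 < Fintype.card α := by
    by_contra h0
    have : IsEmpty α := Fintype.card_eq_zero_iff.1 (by omega)
    have h1 := hcon ∅ (by simp)
    exact h1 fun A _ B _ _ => Subsingleton.elim A B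
  set n : ℝ := ((Fintype.card α : ℕ) : ℝ) with hn
  have hn0 : 0 < n := Nat.cast_pos.2 hpos
  have hcount : n ^ k ≤ ∑ p ∈ 𝒜.offDiag, (#(symmDiff p.1 p.2)ᶜ : ℝ) ^ k := by
    have h1 : (univ : Finset (Fin k → α)) ⊆
        𝒜.offDiag.biUnion fun p => Fintype.piFinset fun _ => (symmDiff p.1 p.2)ᶜ := by
      intro φ _
      obtain ⟨p, hp, hφ⟩ := hpair φ
      exact Finset.mem_biUnion.2 ⟨p, hp, Fintype.mem_piFinset.2 hφ⟩
    have h2 := (Finset.card_le_card h1).trans Finset.card_biUnion_le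
    simp only [Finset.card_univ, Fintype.card_pi_const, Fintype.card_piFinset_const] at h2
    rw [hn]
    exact_mod_cast h2
  have hterm : ∀ p ∈ 𝒜.offDiag,
      (#(symmDiff p.1 p.2)ᶜ : ℝ) ^ k ≤ n ^ k * Real.exp (-(k / a)) := by
    intro p hp
    obtain ⟨hA, hB, hne⟩ := Finset.mem_offDiag.1 hp
    have h1 := hsep _ hA _ hB hne
    have h2 : (#(symmDiff p.1 p.2)ᶜ : ℝ) ≤ n * Real.exp (-(1 / a)) := by
      have h3 := Real.add_one_le_exp (-(1 / a))
      have h4 : n / a ≤ #(symmDiff p.1 p.2) := by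
        rw [div_le_iff₀ (by linarith)]; linarith
      rw [Finset.card_compl, Nat.cast_sub (Finset.card_le_univ _)]
      have h5 : n * (-(1 / a) + 1) = n - n / a := by ring
      have h6 := mul_le_mul_of_nonneg_left h3 hn0.le
      linarith
    calc (#(symmDiff p.1 p.2)ᶜ : ℝ) ^ k ≤ (n * Real.exp (-(1 / a))) ^ k := by gcongr
      _ = n ^ k * Real.exp (-(k / a)) := by
        rw [mul_pow, ← Real.exp_nat_mul]; congr 2; ring
  have h1 := hcount.trans (Finset.sum_le_sum hterm)
  rw [Finset.sum_const, nsmul_eq_mul] at h1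
  have h2 : (#𝒜.offDiag : ℝ) ≤ (#𝒜 : ℝ) ^ 2 := by
    rw [Finset.offDiag_card, pow_two]
    exact_mod_cast Nat.sub_le _ _
  have h3 : (#𝒜.offDiag : ℝ) * (n ^ k * Real.exp (-(k / a)))
      ≤ n ^ k * ((#𝒜 : ℝ) ^ 2 * Real.exp (-(k / a))) := by
    calc _ ≤ (#𝒜 : ℝ) ^ 2 * (n ^ k * Real.exp (-(k / a))) := by gcongr
      _ = _ := by ring
  have h4 : n ^ k * ((#𝒜 : ℝ) ^ 2 * Real.exp (-(k / a))) < n ^ k * 1 := by gcongr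
  linarith

/-- Dudley's packing bound for set families of finite VC dimension. -/
theorem log_card_le_of_separated {α : Type*} [Fintype α] [DecidableEq α]
    {𝒜 : Finset (Finset α)} {d : ℕ} (hd : ∀ s, 𝒜.Shatters s → #s ≤ d) {a : ℝ} (ha : 1 ≤ a)
    (hsep : ∀ A ∈ 𝒜, ∀ B ∈ 𝒜, A ≠ B → (Fintype.card α : ℝ) ≤ a * #(symmDiff A B)) :
    Real.log #𝒜 ≤ 2 * d * Real.log (4 * a) + 1 / 2 := by
  have hlog4 : 0 ≤ Real.log (4 * a) := Real.log_nonneg (by linarith)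
  rcases Nat.eq_zero_or_pos #𝒜 with h0 | h0
  · rw [h0]; simp only [Nat.cast_zero, Real.log_zero]; positivity
  have hN : (0 : ℝ) < #𝒜 := by exact_mod_cast h0
  have hl : 0 ≤ Real.log #𝒜 := Real.log_nonneg (by exact_mod_cast h0)
  set l := Real.log #𝒜 with hldef
  obtain ⟨R, hRk, hR⟩ := exists_card_le_injOn_inter 𝒜 ha hsep (k := ⌊2 * a * l⌋₊ + 1) (by
    have h1 : (#𝒜 : ℝ) ^ 2 = Real.exp (2 * l) := by
      rw [hldef, mul_comm, Real.exp_mul, Real.exp_log hN]; norm_cast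
    rw [h1, ← Real.exp_add, Real.exp_lt_one_iff]
    have h2 := Nat.lt_floor_add_one (2 * a * l)
    have h3 : 2 * l < (((⌊2 * a * l⌋₊ + 1 : ℕ) : ℝ)) / a := by
      rw [lt_div_iff₀ (by linarith)]; push_cast; linarith
    linarith)
  -- Since `#R ≤ 2 * a * l + 1`, this choice of `x` makes `#R * x` at most `l / 2 + 1 / 4`, so half
  -- of `l` is absorbed on the left.
  have hx0 : 0 < 1 / (4 * a) := by positivity
  have hx1 : 1 / (4 * a) ≤ 1 := by rw [div_le_one (by linarith)]; linarith
  have h1 := Real.log_le_log (by positivity) (card_mul_pow_le_of_injOn_inter hd hR hx0 hx1)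
  rw [Real.log_exp, Real.log_mul hN.ne' (by positivity), Real.log_pow, one_div, Real.log_inv] at h1
  have h2 : (#R : ℝ) * (4 * a)⁻¹ ≤ l / 2 + 1 / 4 := by
    have h3 : (#R : ℝ) ≤ 2 * a * l + 1 := by
      have h4 : (#R : ℝ) ≤ ((⌊2 * a * l⌋₊ + 1 : ℕ) : ℝ) := by exact_mod_cast hRk
      have h5 := Nat.floor_le (by positivity : 0 ≤ 2 * a * l)
      push_cast at h4
      linarith
    rw [← div_eq_mul_inv, div_le_iff₀ (by linarith)]
    nlinarith
  linarith

/-- A separated subfamily of maximal size is a net, since an uncovered member could be added to it.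
-/
theorem exists_separated_net {α : Type*} [DecidableEq α] (𝒜 : Finset (Finset α)) {r : ℝ}
    (hr : 0 < r) :
    ∃ 𝒩 ⊆ 𝒜, (∀ A ∈ 𝒩, ∀ B ∈ 𝒩, A ≠ B → r ≤ #(symmDiff A B)) ∧
      ∀ A ∈ 𝒜, ∃ B ∈ 𝒩, (#(symmDiff A B) : ℝ) < r := by
  classical
  obtain ⟨𝒩, h𝒩, hmax⟩ := Finset.exists_max_image
    {𝒩 ∈ 𝒜.powerset | ∀ A ∈ 𝒩, ∀ B ∈ 𝒩, A ≠ B → r ≤ #(symmDiff A B)} Finset.card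
    ⟨∅, by simp⟩
  rw [Finset.mem_filter, Finset.mem_powerset] at h𝒩
  refine ⟨𝒩, h𝒩.1, h𝒩.2, fun A hA => ?_⟩
  by_contra! hcon
  have hA𝒩 : A ∉ 𝒩 := fun h => by
    have := hcon A h
    simp only [symmDiff_self, Finset.bot_eq_empty, Finset.card_empty, Nat.cast_zero] at this
    linarith
  have h1 := hmax (insert A 𝒩) (by
    rw [Finset.mem_filter, Finset.mem_powerset]
    refine ⟨Finset.insert_subset hA h𝒩.1, fun B hB C hC hBC => ?_⟩
    rcases Finset.mem_insert.1 hB with rfl | hB' <;> rcases Finset.mem_insert.1 hC with rfl | hC'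
    · exact absurd rfl hBC
    · exact hcon C hC'
    · rw [symmDiff_comm]; exact hcon B hB'
    · exact h𝒩.2 B hB' C hC' hBC)
  rw [Finset.card_insert_of_notMem hA𝒩] at h1
  omega

/-- The difference of the indicators of the two halves of a subset of `ι ⊕ ι`. -/
def indicatorDiff {ι : Type*} [DecidableEq ι] (A : Finset (ι ⊕ ι)) (i : ι) : ℝ :=
  (if Sum.inl i ∈ A then 1 else 0) - (if Sum.inr i ∈ A then 1 else 0)

/-- Hamming distance controls the variance of the Rademacher increments, which is what chaining
needs. -/
theorem sum_indicatorDiff_sub_sq_le {ι : Type*} [Fintype ι] [DecidableEq ι]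
    (A B : Finset (ι ⊕ ι)) :
    ∑ i, (indicatorDiff A i - indicatorDiff B i) ^ 2 ≤ 2 * #(symmDiff A B) := by
  have h1 : (#(symmDiff A B) : ℝ)
      = ∑ i, ((if Sum.inl i ∈ symmDiff A B then 1 else 0)
          + (if Sum.inr i ∈ symmDiff A B then 1 else 0) : ℝ) := by
    rw [Finset.sum_add_distrib, ← Fintype.sum_sum_type
      (fun x : ι ⊕ ι => if x ∈ symmDiff A B then (1 : ℝ) else 0)]
    simp
  rw [h1, Finset.mul_sum]
  refine Finset.sum_le_sum fun i _ => ?_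
  simp only [indicatorDiff, Finset.mem_symmDiff]
  by_cases h1 : Sum.inl i ∈ A <;> by_cases h2 : Sum.inl i ∈ B <;>
    by_cases h3 : Sum.inr i ∈ A <;> by_cases h4 : Sum.inr i ∈ B <;> simp [h1, h2, h3, h4] <;>
    norm_num

theorem sum_indicatorDiff_sq_le {ι : Type*} [Fintype ι] [DecidableEq ι] (A : Finset (ι ⊕ ι)) :
    ∑ i, indicatorDiff A i ^ 2 ≤ Fintype.card ι := by
  have h1 : (Fintype.card ι : ℝ) = ∑ _i : ι, (1 : ℝ) := by simp
  rw [h1]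
  refine Finset.sum_le_sum fun i _ => ?_
  simp only [indicatorDiff]
  split_ifs <;> norm_num

end Combinatorics

/-! ### Chaining over nets at geometric scales. -/

section Chaining

open Finset

/-- These weights divide the allowed deviation among the chaining scales. -/
theorem sum_range_succ_div_two_pow_le (n : ℕ) :
    ∑ j ∈ range n, ((j : ℝ) + 1) / 2 ^ j ≤ 4 := by
  have h : ∑ j ∈ range n, ((j : ℝ) + 1) / 2 ^ j = 4 - (2 * n + 4) / 2 ^ n := by
    induction n with
    | zero => norm_num
    | succ k ih =>
      rw [Finset.sum_range_succ, ih]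
      push_cast
      field_simp
      ring
  rw [h]
  have : (0 : ℝ) ≤ (2 * n + 4) / 2 ^ n := by positivity
  linarith

theorem sum_range_pow_succ_le {q : ℝ} (hq0 : 0 ≤ q) (hq : q ≤ 1 / 2) (n : ℕ) :
    ∑ j ∈ range n, q ^ (j + 1) ≤ 2 * q := by
  induction n with
  | zero => simpa using hq0
  | succ k ih =>
    rw [Finset.sum_range_succ']
    have h1 : ∑ j ∈ range k, q ^ (j + 1 + 1) = q * ∑ j ∈ range k, q ^ (j + 1) := by
      rw [Finset.mul_sum]; exact Finset.sum_congr rfl fun j _ => by ring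
    rw [h1]
    have h2 := mul_le_mul_of_nonneg_left ih hq0
    have h3 := mul_le_mul_of_nonneg_left hq hq0
    rw [zero_add, pow_one]
    linarith

/-- The contribution of one scale to the chaining union bound. -/
theorem card_mul_exp_le_pow {N : ℕ} {d j : ℕ} {L δ : ℝ} (hδ0 : 0 < δ) (hδ : δ < 1 / 2)
    (hN : Real.log N ≤ 2 * d * Real.log (4 * 4 ^ j) + 1 / 2)
    (hL : 5 * (d + Real.log (1 / δ)) ≤ L) :
    (N : ℝ) * (2 * Real.exp (-(L * ((j : ℝ) + 1) ^ 2))) ≤ 2 * (δ ^ 4) ^ (j + 1) := by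
  have hlog2 := Real.log_two_gt_d9
  have hlog2' := Real.log_two_lt_d9
  have hld : Real.log 2 ≤ Real.log (1 / δ) := by
    apply Real.log_le_log (by norm_num)
    rw [le_div_iff₀ hδ0]; linarith
  rcases Nat.eq_zero_or_pos N with h0 | h0
  · rw [h0]; simp only [Nat.cast_zero, zero_mul]; positivity
  have hN0 : (0 : ℝ) < N := by exact_mod_cast h0
  have hj : (0 : ℝ) ≤ j := Nat.cast_nonneg j
  have hd0 : (0 : ℝ) ≤ d := Nat.cast_nonneg d
  have h4 : Real.log (4 * 4 ^ j) = 2 * (j + 1) * Real.log 2 := by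
    rw [show (4 : ℝ) * 4 ^ j = 2 ^ (2 * (j + 1)) by rw [pow_mul]; norm_num; ring, Real.log_pow]
    push_cast; ring
  have hδe : (δ ^ 4) ^ (j + 1) = Real.exp (-(4 * (j + 1) * Real.log (1 / δ))) := by
    rw [one_div, Real.log_inv, ← pow_mul, ← Real.exp_log (pow_pos hδ0 (4 * (j + 1))),
      Real.log_pow]
    push_cast
    congr 1; ring
  rw [hδe, ← Real.exp_log hN0]
  rw [show Real.exp (Real.log N) * (2 * Real.exp (-(L * ((j : ℝ) + 1) ^ 2)))
    = 2 * Real.exp (Real.log N + -(L * ((j : ℝ) + 1) ^ 2)) by rw [Real.exp_add]; ring]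
  gcongr
  rw [h4] at hN
  have h5 : 5 * (d + Real.log (1 / δ)) * (j + 1) ≤ L * ((j : ℝ) + 1) ^ 2 := by
    calc 5 * (d + Real.log (1 / δ)) * (j + 1) ≤ L * (j + 1) := by gcongr
      _ ≤ L * ((j : ℝ) + 1) ^ 2 := by
        have hl0 : 0 ≤ Real.log (1 / δ) := by linarith
        have : 0 ≤ L := le_trans (by positivity) hL
        gcongr
        nlinarith
  -- The factor `5` exceeds `4 * log 2`, which settles the `d` term; four of the five copies of `log
  -- (1/δ)` give `δ ^ 4`, and the fifth covers the `1 / 2`.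
  have h6 : 2 * (d : ℝ) * (2 * (j + 1) * Real.log 2) ≤ 5 * d * (j + 1) := by
    have : 0 ≤ (d : ℝ) * (j + 1) := by positivity
    nlinarith
  have h7 : 1 / 2 ≤ Real.log (1 / δ) * (j + 1) := by nlinarith
  linarith

/-- Maximal inequality for the Rademacher process indexed by a family of finite VC dimension,
without logarithmic loss. -/
theorem card_sup_rademacher_gt_le {ι : Type*} [Fintype ι] [DecidableEq ι]
    (𝒜 : Finset (Finset (ι ⊕ ι))) {d : ℕ} (hd : ∀ s, 𝒜.Shatters s → #s ≤ d) {η δ : ℝ}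
    (hη : 0 < η) (hδ0 : 0 < δ) (hδ : δ < 1 / 2)
    (hm : 2560 * (d + Real.log (1 / δ)) ≤ η ^ 2 * Fintype.card ι) :
    (#{σ : ι → Bool | ∃ A ∈ 𝒜,
        η * Fintype.card ι < |∑ i, boolSign (σ i) * indicatorDiff A i|} : ℝ)
      ≤ 2 ^ Fintype.card ι * (δ / 2) := by
  set m : ℝ := ((Fintype.card ι : ℕ) : ℝ) with hmdef
  have hlog : 0 < Real.log (1 / δ) := Real.log_pos (by rw [lt_div_iff₀ hδ0]; linarith)
  have hm0 : 0 < m := by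
    have h1 : 0 < η ^ 2 * m := lt_of_lt_of_le (by positivity) hm
    exact pos_of_mul_pos_right h1 (by positivity)
  have hcard : ((Fintype.card (ι ⊕ ι) : ℕ) : ℝ) = 2 * m := by
    rw [Fintype.card_sum]; push_cast; ring
  choose N hNsub hNsep hNcov using fun j : ℕ =>
    exists_separated_net 𝒜 (r := 2 * m / 4 ^ j) (by positivity)
  choose! p hpN hpd using hNcov
  -- Links of the chain: at level `0` the set itself, at level `k + 1` the increment from a net
  -- point to its approximation in `N k`.
  let w : ℕ → Finset (ι ⊕ ι) → ι → ℝ := fun j => Nat.casesOn j indicatorDiff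
    fun k A i => indicatorDiff A i - indicatorDiff (p k A) i
  let t : ℕ → ℝ := fun j => η / 4 * m * ((j + 1) / 2 ^ j)
  have hw : ∀ j, ∀ A ∈ N j, ∑ i, w j A i ^ 2 ≤ 16 * m / 4 ^ j := by
    intro j A hA
    cases j with
    | zero =>
      have := sum_indicatorDiff_sq_le A
      rw [pow_zero, div_one]
      exact this.trans (by linarith)
    | succ k =>
      have h1 := sum_indicatorDiff_sub_sq_le A (p k A)
      have h2 := hpd k A (hNsub _ hA)
      simp only [w]
      refine h1.trans ?_
      rw [show 16 * m / 4 ^ (k + 1) = 2 * (2 * m / 4 ^ k) by rw [pow_succ]; field_simp; ring]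
      linarith
  have hlogN : ∀ j, Real.log #(N j) ≤ 2 * d * Real.log (4 * 4 ^ j) + 1 / 2 := by
    intro j
    refine log_card_le_of_separated (fun s hs => hd s (hs.mono_left (hNsub j)))
      (one_le_pow₀ (by norm_num)) fun A hA B hB hAB => ?_
    have := hNsep j A hA B hB hAB
    rw [hcard]
    rw [div_le_iff₀ (by positivity)] at this
    linarith
  -- At level `J` the radius is below one, so `N J` is all of `𝒜` and the chain ends with no
  -- remainder.
  obtain ⟨J, hJ⟩ := pow_unbounded_of_one_lt (2 * m) (by norm_num : (1 : ℝ) < 4)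
  have hsub : ({σ : ι → Bool | ∃ A ∈ 𝒜,
        η * m < |∑ i, boolSign (σ i) * indicatorDiff A i|} : Finset (ι → Bool)) ⊆
      (range (J + 1)).biUnion fun j => (N j).biUnion fun A =>
        {σ : ι → Bool | t j ≤ |∑ i, boolSign (σ i) * w j A i|} := by
    intro σ hσ
    rw [Finset.mem_filter] at hσ
    obtain ⟨-, A, hA, hbig⟩ := hσ
    by_contra hnot
    simp only [Finset.mem_biUnion, Finset.mem_range, Finset.mem_filter, Finset.mem_univ, true_and,
      not_exists, not_and, not_le] at hnot
    have hind : ∀ j < J + 1, ∀ B ∈ N j, |∑ i, boolSign (σ i) * indicatorDiff B i|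
        ≤ ∑ k ∈ range (j + 1), t k := by
      intro j
      induction j with
      | zero =>
        intro hj B hB
        have := hnot 0 hj B hB
        rw [Finset.sum_range_one]
        exact this.le
      | succ k ih =>
        intro hj B hB
        have h1 := hnot (k + 1) hj B hB
        have h2 := ih (by omega) (p k B) (hpN k B (hNsub _ hB))
        simp only [w, mul_sub, Finset.sum_sub_distrib] at h1
        rw [Finset.sum_range_succ]
        have h3 := abs_sub_abs_le_abs_sub (∑ i, boolSign (σ i) * indicatorDiff B i)
          (∑ i, boolSign (σ i) * indicatorDiff (p k B) i)
        linarith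
    have hAJ : A ∈ N J := by
      have h1 := hpd J A hA
      have h2 : 2 * m / 4 ^ J < 1 := by rw [div_lt_one (by positivity)]; exact hJ
      have h3 : #(symmDiff A (p J A)) = 0 := by
        have : (#(symmDiff A (p J A)) : ℝ) < ((1 : ℕ) : ℝ) := by push_cast; linarith
        have := Nat.cast_lt.1 this
        omega
      have h4 : A = p J A := by
        rw [Finset.card_eq_zero] at h3
        exact symmDiff_eq_bot.1 h3
      rw [h4]
      exact hpN J A hA
    have h1 := hind J (by omega) A hAJ
    have h2 : ∑ k ∈ range (J + 1), t k ≤ η * m := by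
      simp only [t]
      rw [← Finset.mul_sum]
      have h3 := mul_le_mul_of_nonneg_left (sum_range_succ_div_two_pow_le (J + 1))
        (by positivity : 0 ≤ η / 4 * m)
      linarith
    linarith
  -- The variance factor `4 ^ j` cancels the square of `2 ^ j` in `t j`. The resulting `512`, times
  -- the `5` of `card_mul_exp_le_pow`, is the `2560` in the hypothesis.
  have hlink : ∀ j, ∀ A ∈ N j, (#{σ : ι → Bool | t j ≤ |∑ i, boolSign (σ i) * w j A i|} : ℝ)
      ≤ 2 ^ Fintype.card ι * (2 * Real.exp (-(η ^ 2 * m / 512 * ((j : ℝ) + 1) ^ 2))) := by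
    intro j A hA
    have h1 := card_abs_rademacher_ge_le (w j A) (by positivity) (hw j A hA)
      (by positivity : 0 ≤ t j)
    rw [show t j ^ 2 / (2 * (16 * m / 4 ^ j)) = η ^ 2 * m / 512 * ((j : ℝ) + 1) ^ 2 by
      simp only [t]
      have : (4 : ℝ) ^ j = 2 ^ j * 2 ^ j := by rw [← mul_pow]; norm_num
      rw [this]
      field_simp
      ring] at h1
    exact h1
  calc _ ≤ ∑ j ∈ range (J + 1), ∑ A ∈ N j,
        (#{σ : ι → Bool | t j ≤ |∑ i, boolSign (σ i) * w j A i|} : ℝ) := by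
        have := (Finset.card_le_card hsub).trans (Finset.card_biUnion_le.trans
          (Finset.sum_le_sum fun j _ => Finset.card_biUnion_le))
        exact_mod_cast this
    _ ≤ ∑ j ∈ range (J + 1), 2 ^ Fintype.card ι * (2 * (δ ^ 4) ^ (j + 1)) := by
        refine Finset.sum_le_sum fun j _ => (Finset.sum_le_sum (hlink j)).trans ?_
        rw [Finset.sum_const, nsmul_eq_mul, mul_left_comm]
        refine mul_le_mul_of_nonneg_left ?_ (by positivity)
        exact card_mul_exp_le_pow hδ0 hδ (hlogN j) (by linarith)
    _ ≤ 2 ^ Fintype.card ι * (δ / 2) := by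
        rw [← Finset.mul_sum, ← Finset.mul_sum]
        have h3 : δ ^ 3 ≤ (1 / 2) ^ 3 := by gcongr
        have h4 : δ ^ 4 ≤ δ / 8 := by
          have := mul_le_mul_of_nonneg_left h3 hδ0.le
          linarith [show δ ^ 4 = δ * δ ^ 3 by ring]
        have h5 := sum_range_pow_succ_le (by positivity : 0 ≤ δ ^ 4) (by linarith) (J + 1)
        gcongr
        linarith

end Chaining


/-! ### From the VC dimension of a class to that of its error sets. -/

section Trace

open Finset

variable {X : Type u}

theorem label_eq_of_ne_iff {a b y : Label} (h : a ≠ y ↔ b ≠ y) : a = b := by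
  revert a b y
  decide

open Classical in
/-- The indices of the labelled points in `z` that `f` misclassifies. -/
noncomputable def errorSet {κ : Type*} [Fintype κ] (z : κ → X × Label) (f : X → Label) : Finset κ :=
  {a | f (z a).1 ≠ (z a).2}

theorem mem_errorSet {κ : Type*} [Fintype κ] {z : κ → X × Label} {f : X → Label} {a : κ} :
    a ∈ errorSet z f ↔ f (z a).1 ≠ (z a).2 := by
  simp [errorSet]

open Classical in
/-- The error sets of all the members of a class. -/
noncomputable def errorFamily {κ : Type*} [Fintype κ] (z : κ → X × Label) (F : Set (X → Label)) :
    Finset (Finset κ) :=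
  {A | ∃ f ∈ F, errorSet z f = A}

theorem mem_errorFamily {κ : Type*} [Fintype κ] {z : κ → X × Label} {F : Set (X → Label)}
    {A : Finset κ} : A ∈ errorFamily z F ↔ ∃ f ∈ F, errorSet z f = A := by
  simp [errorFamily]

theorem card_le_of_shatters {F : Set (X → Label)} {d : ℕ} (hd : vcDim F ≤ d) {A : Finset X}
    (hA : Shatters F A) : #A ≤ d := by
  have h : (#A : ℕ∞) ≤ vcDim F := le_iSup₂_of_le A hA le_rfl
  exact_mod_cast h.trans hd

theorem card_le_of_shatters_errorFamily {κ : Type*} [Fintype κ] [DecidableEq κ]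
    {F : Set (X → Label)} {d : ℕ} (hd : vcDim F ≤ d) (z : κ → X × Label) {s : Finset κ}
    (hs : (errorFamily z F).Shatters s) : #s ≤ d := by
  classical
  have key : ∀ t ⊆ s, ∃ f ∈ F, ∀ a ∈ s, (a ∈ t ↔ f (z a).1 ≠ (z a).2) := by
    intro t ht
    obtain ⟨u, hu, hut⟩ := hs ht
    obtain ⟨f, hf, rfl⟩ := mem_errorFamily.1 hu
    refine ⟨f, hf, fun a ha => ?_⟩
    rw [← hut, Finset.mem_inter, mem_errorSet]
    exact and_iff_right ha
  -- Two shattered indices cannot share an instance: with equal labels they are misclassified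
  -- together, with opposite labels never both.
  have hinj : Set.InjOn (fun a => (z a).1) (s : Set κ) := by
    intro a ha b hb hab
    by_contra hne
    by_cases hy : (z a).2 = (z b).2
    · obtain ⟨f, -, hf⟩ := key {a} (by simpa using ha)
      have h1 := (hf a ha).1 (Finset.mem_singleton_self a)
      simp only at hab
      rw [hab, hy] at h1
      exact hne (Finset.mem_singleton.1 ((hf b hb).2 h1)).symm
    · obtain ⟨f, -, hf⟩ := key s (Finset.Subset.refl s)
      have h1 := (hf a ha).1 ha
      have h2 := (hf b hb).1 hb
      simp only at hab
      rw [hab] at h1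
      revert h1 h2 hy
      generalize f (z b).1 = x
      generalize (z a).2 = y
      generalize (z b).2 = y'
      revert x y y'
      decide
  rw [← Finset.card_image_of_injOn hinj]
  refine card_le_of_shatters hd fun g => ?_
  -- With two labels, agreeing with `g` on being wrong at a labelled point means agreeing with `g`
  -- there.
  obtain ⟨f, hf, hfs⟩ := key (s.filter fun a => g (z a).1 ≠ (z a).2) (Finset.filter_subset _ _)
  refine ⟨f, hf, fun x hx => ?_⟩
  obtain ⟨a, ha, rfl⟩ := Finset.mem_image.1 hx
  refine label_eq_of_ne_iff (y := (z a).2) ?_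
  rw [← hfs a ha, Finset.mem_filter]
  exact and_iff_right ha

end Trace

/-! ### Discrepancy of a double sample under exchanges. -/

section Empirical

variable {X : Type u} {m : ℕ}

theorem empErr_nonneg (S : Fin m → X × Label) (f : X → Label) : 0 ≤ empErr S f := by
  unfold empErr
  refine mul_nonneg (by positivity) (Finset.sum_nonneg fun i _ => ?_)
  split_ifs <;> norm_num

theorem empErr_le_one (S : Fin m → X × Label) (f : X → Label) : empErr S f ≤ 1 := by
  unfold empErr
  have h : ∑ i, (if f (S i).1 ≠ (S i).2 then (1 : ℝ) else 0) ≤ m := by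
    calc _ ≤ ∑ _i : Fin m, (1 : ℝ) := Finset.sum_le_sum fun i _ => by split_ifs <;> norm_num
      _ = m := by simp
  rw [one_div, inv_mul_eq_div]
  exact div_le_one_of_le₀ h (Nat.cast_nonneg m)

theorem abs_empErr_sub_empErr_le_one (S S' : Fin m → X × Label) (f : X → Label) :
    |empErr S f - empErr S' f| ≤ 1 :=
  abs_sub_le_of_nonneg_of_le (empErr_nonneg _ _) (empErr_le_one _ _) (empErr_nonneg _ _)
    (empErr_le_one _ _)

/-- The largest discrepancy over `F` between the empirical errors on two samples. -/
noncomputable def discrepancy (F : Set (X → Label)) (p : (Fin m → X × Label) × (Fin m → X × Label)) : ℝ :=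
  ⨆ f : F, |empErr p.1 (f : X → Label) - empErr p.2 (f : X → Label)|

theorem abs_sub_le_discrepancy {F : Set (X → Label)} {f : X → Label} (hf : f ∈ F)
    (p : (Fin m → X × Label) × (Fin m → X × Label)) :
    |empErr p.1 f - empErr p.2 f| ≤ discrepancy F p :=
  le_ciSup (f := fun f : F => |empErr p.1 (f : X → Label) - empErr p.2 (f : X → Label)|)
    ⟨1, by rintro _ ⟨g, rfl⟩; exact abs_empErr_sub_empErr_le_one _ _ _⟩ ⟨f, hf⟩

/-- Exchange the two samples at the indices where `σ` is `false`. -/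
def swapSamples {Z : Type*} (σ : Fin m → Bool) (p : (Fin m → Z) × (Fin m → Z)) :
    (Fin m → Z) × (Fin m → Z) :=
  (fun i => if σ i then p.1 i else p.2 i, fun i => if σ i then p.2 i else p.1 i)

theorem empErr_swapSamples_sub (σ : Fin m → Bool)
    (p : (Fin m → X × Label) × (Fin m → X × Label)) (f : X → Label) :
    empErr (swapSamples σ p).1 f - empErr (swapSamples σ p).2 f
      = (1 / (m : ℝ)) * ∑ i, boolSign (σ i) * indicatorDiff (errorSet (Sum.elim p.1 p.2) f) i := by
  unfold empErr
  rw [← mul_sub, ← Finset.sum_sub_distrib]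
  congr 1
  refine Finset.sum_congr rfl fun i _ => ?_
  simp only [indicatorDiff, mem_errorSet, Sum.elim_inl, Sum.elim_inr, swapSamples, boolSign]
  rcases Bool.eq_false_or_eq_true (σ i) with h | h <;> simp only [h] <;> simp

/-- Given a double sample, few exchanges of it have a large discrepancy. -/
theorem card_discrepancy_swapSamples_gt_le {F : Set (X → Label)} (hF : F.Nonempty) {d : ℕ}
    (hd : vcDim F ≤ d) {η δ : ℝ} (hη : 0 < η) (hδ0 : 0 < δ) (hδ : δ < 1 / 2)
    (hm : 2560 * (d + Real.log (1 / δ)) ≤ η ^ 2 * m)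
    (p : (Fin m → X × Label) × (Fin m → X × Label)) :
    ((Finset.univ.filter fun σ : Fin m → Bool => η < discrepancy F (swapSamples σ p)).card : ℝ)
      ≤ 2 ^ m * (δ / 2) := by
  have h := card_sup_rademacher_gt_le (errorFamily (Sum.elim p.1 p.2) F)
    (fun s hs => card_le_of_shatters_errorFamily hd _ hs) hη hδ0 hδ (by simpa using hm)
  rw [Fintype.card_fin] at h
  refine le_trans (Nat.cast_le.2 (Finset.card_le_card fun σ hσ => ?_)) h
  simp only [Finset.mem_filter, Finset.mem_univ, true_and] at hσ ⊢
  have : Nonempty F := hF.to_subtype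
  obtain ⟨f, hf⟩ := exists_lt_of_lt_ciSup hσ
  refine ⟨_, mem_errorFamily.2 ⟨f, f.2, rfl⟩, ?_⟩
  rw [empErr_swapSamples_sub, abs_mul, abs_of_nonneg (by positivity : 0 ≤ 1 / (m : ℝ))] at hf
  rcases Nat.eq_zero_or_pos m with h0 | h0
  -- For `m = 0` the factor `1 / m` is `0`, so `hf` would give `η < 0`.
  · subst h0; simp at hf; linarith
  · rw [one_div, inv_mul_eq_div, lt_div_iff₀ (by exact_mod_cast h0)] at hf
    exact hf

end Empirical

/-- Viewed as `m` independent pairs, the double sample is changed in each coordinate by the identity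
or by `Prod.swap`, and both preserve `D.prod D`. -/
theorem measurePreserving_swapSamples {Z : Type*} [MeasurableSpace Z] (D : Measure Z)
    [IsProbabilityMeasure D] {m : ℕ} (σ : Fin m → Bool) :
    MeasurePreserving (swapSamples σ)
      ((Measure.pi fun _ : Fin m => D).prod (Measure.pi fun _ : Fin m => D))
      ((Measure.pi fun _ : Fin m => D).prod (Measure.pi fun _ : Fin m => D)) := by
  have h1 := measurePreserving_arrowProdEquivProdArrow Z Z (Fin m) (fun _ => D) (fun _ => D)
  have h2 : MeasurePreserving (fun (q : Fin m → Z × Z) i => (if σ i then id else Prod.swap) (q i))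
      (Measure.pi fun _ => D.prod D) (Measure.pi fun _ => D.prod D) := by
    refine measurePreserving_pi (f := fun i => if σ i then id else Prod.swap)
      (fun _ => D.prod D) (fun _ => D.prod D) fun i => ?_
    cases σ i
    · simpa using Measure.measurePreserving_swap
    · simpa using MeasurePreserving.id _
  convert h1.comp (h2.comp (h1.symm _)) using 1
  funext p
  simp only [swapSamples, Function.comp]
  refine Prod.ext ?_ ?_ <;> funext i <;> cases h : σ i <;>
    simp [MeasurableEquiv.arrowProdEquivProdArrow, Equiv.arrowProdEquivProdArrow, h]

/-! ### Symmetrization and uniform convergence. -/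

section Probability

open ProbabilityTheory

variable {X : Type u} [MeasurableSpace X]

instance (D : Measure (X × Label)) [IsProbabilityMeasure D] (m : ℕ) :
    IsProbabilityMeasure (sampleLaw D m) := by
  unfold sampleLaw; infer_instance

theorem measurableSet_error {f : X → Label} (hf : Measurable f) :
    MeasurableSet {p : X × Label | f p.1 ≠ p.2} :=
  (measurableSet_eq_fun (hf.comp measurable_fst) measurable_snd).compl

/-- Tail bound for the discrepancy of two independent samples, for any measurable version. -/
theorem measure_discrepancy_gt_le (D : Measure (X × Label)) [IsProbabilityMeasure D]
    {F : Set (X → Label)} (hF : F.Nonempty) {d m : ℕ} (hd : vcDim F ≤ d) {η δ : ℝ} (hη : 0 < η)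
    (hδ0 : 0 < δ) (hδ : δ < 1 / 2) (hm : 2560 * (d + Real.log (1 / δ)) ≤ η ^ 2 * m)
    {g : (Fin m → X × Label) × (Fin m → X × Label) → ℝ} (hg : Measurable g)
    (hgF : discrepancy F =ᵐ[(sampleLaw D m).prod (sampleLaw D m)] g) :
    ((sampleLaw D m).prod (sampleLaw D m)) {p | η < g p} ≤ ENNReal.ofReal (δ / 2) := by
  set P := (sampleLaw D m).prod (sampleLaw D m) with hP
  have hmp : ∀ σ : Fin m → Bool, MeasurePreserving (swapSamples σ) P P := fun σ =>
    measurePreserving_swapSamples D σ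
  have hA : MeasurableSet {p | η < g p} := measurableSet_lt measurable_const hg
  -- There are finitely many exchanges, so one null set handles the passage from `discrepancy F` to
  -- `g` for all of them.
  have hae : ∀ᵐ p ∂P, ∀ σ : Fin m → Bool,
      discrepancy F (swapSamples σ p) = g (swapSamples σ p) :=
    ae_all_iff.2 fun σ => (hmp σ).quasiMeasurePreserving.ae hgF
  -- All `2 ^ m` exchanges of the event have the same probability; summing them under the integral
  -- leaves the pointwise count.
  have hsum : (2 : ENNReal) ^ m * P {p | η < g p} ≤ 2 ^ m * ENNReal.ofReal (δ / 2) := by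
    calc (2 : ENNReal) ^ m * P {p | η < g p}
        = ∑ σ : Fin m → Bool, P (swapSamples σ ⁻¹' {p | η < g p}) := by
          rw [Finset.sum_congr rfl fun σ _ => (hmp σ).measure_preimage hA.nullMeasurableSet]
          simp
      _ = ∫⁻ p, ∑ σ : Fin m → Bool,
            (swapSamples σ ⁻¹' {p | η < g p}).indicator (fun _ => (1 : ENNReal)) p ∂P := by
          rw [lintegral_finsetSum _ fun σ _ =>
            measurable_const.indicator ((hmp σ).measurable hA)]
          exact Finset.sum_congr rfl fun σ _ =>
            (lintegral_indicator_one ((hmp σ).measurable hA)).symm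
      _ ≤ ∫⁻ _, 2 ^ m * ENNReal.ofReal (δ / 2) ∂P := by
          refine lintegral_mono_ae ?_
          filter_upwards [hae] with p hp
          have h1 := card_discrepancy_swapSamples_gt_le hF hd hη hδ0 hδ hm p
          have h2 : ∑ σ : Fin m → Bool,
              (swapSamples σ ⁻¹' {p | η < g p}).indicator (fun _ => (1 : ENNReal)) p
              = ((Finset.univ.filter fun σ : Fin m → Bool =>
                  η < discrepancy F (swapSamples σ p)).card : ENNReal) := by
            rw [Finset.card_filter, Nat.cast_sum]
            refine Finset.sum_congr rfl fun σ _ => ?_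
            simp [Set.indicator_apply, hp σ]
          rw [h2, ← ENNReal.ofReal_natCast]
          refine (ENNReal.ofReal_le_ofReal h1).trans_eq ?_
          rw [ENNReal.ofReal_mul (by positivity), ENNReal.ofReal_pow (by norm_num)]
          simp
      _ = _ := by simp
  exact (ENNReal.mul_le_mul_iff_right (by simp) (by simp)).1 hsum

/-- Chebyshev's inequality for the empirical error of a single classifier. -/
theorem measure_abs_empErr_sub_err_ge_le (D : Measure (X × Label)) [IsProbabilityMeasure D]
    {f : X → Label} (hf : Measurable f) {m : ℕ} {η : ℝ} (hη : 0 < η) (hm : 1 / 2 ≤ η ^ 2 * m) :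
    sampleLaw D m {S | η ≤ |empErr S f - err D f|} ≤ ENNReal.ofReal (1 / 2) := by
  have hm0 : (0 : ℝ) < m := by
    have h1 : 0 < η ^ 2 * m := by linarith
    exact pos_of_mul_pos_right h1 (by positivity)
  let loss : X × Label → ℝ := fun z => if f z.1 ≠ z.2 then 1 else 0
  have hloss : Measurable loss :=
    Measurable.ite (measurableSet_error hf) measurable_const measurable_const
  have hmem : MemLp loss 2 D := by
    refine MemLp.of_bound hloss.aestronglyMeasurable 1 (Filter.Eventually.of_forall fun z => ?_)
    simp only [loss]; split_ifs <;> norm_num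
  have hint : ∫ z, loss z ∂D = err D f := by
    have : loss = Set.indicator {p : X × Label | f p.1 ≠ p.2} 1 := by
      funext z; simp [loss, Set.indicator_apply]
    rw [this, integral_indicator_one (measurableSet_error hf)]
    rfl
  let tot : (Fin m → X × Label) → ℝ := ∑ i, fun S => loss (S i)
  have hmemi : ∀ i : Fin m, MemLp (fun S : Fin m → X × Label => loss (S i)) 2 (sampleLaw D m) :=
    fun i => hmem.comp_measurePreserving (measurePreserving_eval (fun _ : Fin m => D) i)
  have htot : MemLp tot 2 (sampleLaw D m) := memLp_finsetSum' _ fun i _ => hmemi i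
  have hmean : (sampleLaw D m)[tot] = m * err D f := by
    simp only [tot, Finset.sum_apply]
    rw [integral_finsetSum _ fun i _ => (hmemi i).integrable (by norm_num)]
    have : ∀ i : Fin m, ∫ S, loss (S i) ∂(sampleLaw D m) = err D f := fun i => by
      rw [← hint]
      exact integral_comp_eval (μ := fun _ : Fin m => D) hloss.aestronglyMeasurable
    simp [this]
  -- A `[0, 1]`-valued loss has variance at most `1 / 4`; Chebyshev's ratio is then `1 / (4 η² m) ≤
  -- 1 / 2`.
  have hvar : Var[tot; sampleLaw D m] ≤ m / 4 := by
    have h1 : Var[tot; sampleLaw D m] = ∑ _i : Fin m, Var[loss; D] :=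
      variance_sum_pi (μ := fun _ : Fin m => D) (X := fun _ => loss) fun _ => hmem
    have h2 : Var[loss; D] ≤ ((1 - 0) / 2) ^ 2 := by
      refine variance_le_sq_of_bounded (Filter.Eventually.of_forall fun z => ?_)
        hloss.aemeasurable
      simp only [loss]; split_ifs <;> simp
    rw [h1, Finset.sum_const, Finset.card_univ, Fintype.card_fin, nsmul_eq_mul]
    have := mul_le_mul_of_nonneg_left h2 hm0.le
    linarith
  have hcheb := meas_ge_le_variance_div_sq htot (mul_pos hη hm0)
  refine (measure_mono fun S hS => ?_).trans (hcheb.trans (ENNReal.ofReal_le_ofReal ?_))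
  · rw [Set.mem_ofPred_eq] at hS ⊢
    rw [hmean]
    have h1 : tot S = m * empErr S f := by
      simp only [tot, Finset.sum_apply, empErr, loss]
      field_simp
    rw [h1, ← mul_sub, abs_mul, abs_of_pos hm0, mul_comm]
    exact mul_le_mul_of_nonneg_left hS hm0.le
  · rw [div_le_iff₀ (by positivity)]
    have : (m : ℝ) / 4 ≤ 1 / 2 * (η * m) ^ 2 := by
      have := mul_le_mul_of_nonneg_left hm hm0.le
      nlinarith
    linarith

/-- Uniform convergence at the optimal rate for classes of finite VC dimension. -/
theorem measure_exists_abs_err_sub_empErr_gt_le (D : Measure (X × Label))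
    [IsProbabilityMeasure D] {F : Set (X → Label)} (hF : F.Nonempty) {d m : ℕ}
    (hd : vcDim F ≤ d) {η δ : ℝ} (hη : 0 < η) (hδ0 : 0 < δ) (hδ : δ < 1 / 2)
    (hm : 2560 * (d + Real.log (1 / δ)) ≤ η ^ 2 * m) (hFm : WellBehaved D F m) :
    sampleLaw D m {S | ∃ f ∈ F, 2 * η < |err D f - empErr S f|} ≤ ENNReal.ofReal δ := by
  set μ := sampleLaw D m with hμ
  have hdisc : AEMeasurable (discrepancy F) (μ.prod μ) := hFm.aemeasurable_discrepancy
  let g := hdisc.mk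
  have hg : Measurable g := hdisc.measurable_mk
  have hA : MeasurableSet {p | η < g p} := measurableSet_lt measurable_const hg
  have htail := measure_discrepancy_gt_le D hF hd hη hδ0 hδ hm hg hdisc.ae_eq_mk
  have hm' : 1 / 2 ≤ η ^ 2 * m := by
    have h1 := Real.log_two_gt_d9
    have h2 : Real.log 2 ≤ Real.log (1 / δ) := by
      apply Real.log_le_log (by norm_num)
      rw [le_div_iff₀ hδ0]; linarith
    have h3 : (0 : ℝ) ≤ d := Nat.cast_nonneg d
    linarith
  -- If `f` is off by more than `2 * η` on `S`, a ghost sample estimates it within `η` with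
  -- probability at least `1 / 2`, and then the discrepancy exceeds `η`.
  have hbad : ∀ᵐ S ∂μ, (∃ f ∈ F, 2 * η < |err D f - empErr S f|) →
      ENNReal.ofReal (1 / 2) ≤ μ (Prod.mk S ⁻¹' {p | η < g p}) := by
    filter_upwards [Measure.ae_ae_of_ae_prod hdisc.ae_eq_mk] with S hS
    rintro ⟨f, hf, hfS⟩
    have h1 := measure_abs_empErr_sub_err_ge_le D (hFm.measurable f hf) hη hm'
    have h2 : μ {S' | ¬ discrepancy F (S, S') = g (S, S')} = 0 := hS
    have h3 : (Set.univ : Set (Fin m → X × Label)) ⊆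
        (Prod.mk S ⁻¹' {p | η < g p} ∪ {S' | η ≤ |empErr S' f - err D f|})
          ∪ {S' | ¬ discrepancy F (S, S') = g (S, S')} := by
      intro S' _
      by_cases h4 : η ≤ |empErr S' f - err D f|
      · exact Or.inl (Or.inr h4)
      by_cases h5 : discrepancy F (S, S') = g (S, S')
      · refine Or.inl (Or.inl ?_)
        change η < g (S, S')
        rw [← h5]
        have h6 := abs_sub_le_discrepancy hf (S, S')
        have h7 := abs_sub_le (err D f) (empErr S' f) (empErr S f)
        rw [abs_sub_comm (err D f) (empErr S' f), abs_sub_comm (empErr S' f) (empErr S f)] at h7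
        simp only at h6
        linarith
      · exact Or.inr h5
    have h4 : (1 : ENNReal) ≤ μ (Prod.mk S ⁻¹' {p | η < g p}) + ENNReal.ofReal (1 / 2) := by
      calc (1 : ENNReal) = μ Set.univ := measure_univ.symm
        _ ≤ _ := measure_mono h3
        _ ≤ _ := measure_union_le _ _
        _ ≤ (μ (Prod.mk S ⁻¹' {p | η < g p}) + μ {S' | η ≤ |empErr S' f - err D f|}) + 0 := by
          rw [h2]; gcongr; exact measure_union_le _ _
        _ ≤ _ := by rw [add_zero]; gcongr
    have h5 : (1 : ENNReal) = ENNReal.ofReal (1 / 2) + ENNReal.ofReal (1 / 2) := by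
      rw [← ENNReal.ofReal_add (by norm_num) (by norm_num)]; norm_num
    rw [h5] at h4
    exact (ENNReal.add_le_add_iff_right ENNReal.ofReal_ne_top).1 h4
  have hmarkov := mul_meas_ge_le_lintegral (μ := μ) (measurable_measure_prodMk_left (ν := μ) hA)
    (ENNReal.ofReal (1 / 2))
  rw [← Measure.prod_apply hA] at hmarkov
  -- The bad set may be non-measurable; up to a null set it lies in the measurable set of `S` with
  -- large sections, to which Markov's inequality applies.
  have h1 : μ {S | ∃ f ∈ F, 2 * η < |err D f - empErr S f|}
      ≤ μ {S | ENNReal.ofReal (1 / 2) ≤ μ (Prod.mk S ⁻¹' {p | η < g p})} :=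
    measure_mono_ae hbad
  have h2 : ENNReal.ofReal (1 / 2) * μ {S | ∃ f ∈ F, 2 * η < |err D f - empErr S f|}
      ≤ ENNReal.ofReal (1 / 2) * ENNReal.ofReal δ := by
    rw [← ENNReal.ofReal_mul (by norm_num), one_div_mul_eq_div]
    exact (mul_le_mul_right h1 _).trans (hmarkov.trans htail)
  exact (ENNReal.mul_le_mul_iff_right (by simp) ENNReal.ofReal_ne_top).1 h2

end Probability

/-! ### From uniform convergence to regret. -/

section Regret

theorem abs_ciInf_sub_ciInf_le {ι : Type*} [Nonempty ι] {a b : ι → ℝ} {η : ℝ}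
    (ha : BddBelow (Set.range a)) (hb : BddBelow (Set.range b)) (h : ∀ i, |a i - b i| ≤ η) :
    |(⨅ i, a i) - ⨅ i, b i| ≤ η := by
  rw [abs_sub_le_iff]
  constructor
  · rw [sub_le_comm]
    refine le_ciInf fun i => ?_
    linarith [ciInf_le ha i, (abs_sub_le_iff.1 (h i)).1]
  · rw [sub_le_comm]
    refine le_ciInf fun i => ?_
    linarith [ciInf_le hb i, (abs_sub_le_iff.1 (h i)).2]

theorem abs_ciSup_sub_ciSup_le {ι : Type*} [Nonempty ι] {a b : ι → ℝ} {η : ℝ}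
    (ha : BddAbove (Set.range a)) (hb : BddAbove (Set.range b)) (h : ∀ i, |a i - b i| ≤ η) :
    |(⨆ i, a i) - ⨆ i, b i| ≤ η := by
  rw [abs_sub_le_iff]
  constructor
  · rw [sub_le_iff_le_add]
    refine ciSup_le fun i => ?_
    linarith [le_ciSup hb i, (abs_sub_le_iff.1 (h i)).1]
  · rw [sub_le_iff_le_add]
    refine ciSup_le fun i => ?_
    linarith [le_ciSup ha i, (abs_sub_le_iff.1 (h i)).2]

variable {X : Type u} [MeasurableSpace X]

/-- The error and the `opt` term each contribute `η`. Errors lie in `[0, 1]`, so the real infima and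
suprema are genuine rather than default values. -/
theorem abs_worstRegret_sub_empWorstRegret_le (D : Measure (X × Label)) [IsProbabilityMeasure D]
    {H : Set (X → Label)} {𝒯 : Set (X → X)} (h𝒯 : 𝒯.Nonempty) {m : ℕ} {S : Fin m → X × Label}
    {η : ℝ} (hS : ∀ f ∈ compClass H 𝒯, |err D f - empErr S f| ≤ η) {h : X → Label} (hh : h ∈ H) :
    |worstRegret D H 𝒯 h - empWorstRegret S H 𝒯 h| ≤ 2 * η := by
  have : Nonempty 𝒯 := h𝒯.to_subtype
  have : Nonempty H := ⟨⟨h, hh⟩⟩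
  have herr0 : ∀ f, 0 ≤ err D f := fun _ => measureReal_nonneg
  have herr1 : ∀ f, err D f ≤ 1 := fun _ => measureReal_le_one
  have hopt : ∀ T ∈ 𝒯, |opt D H T - empOpt S H T| ≤ η := fun T hT =>
    abs_ciInf_sub_ciInf_le ⟨0, by rintro _ ⟨_, rfl⟩; exact herr0 _⟩
      ⟨0, by rintro _ ⟨_, rfl⟩; exact empErr_nonneg _ _⟩ fun h' => hS _ ⟨h', h'.2, T, hT, rfl⟩
  refine abs_ciSup_sub_ciSup_le ⟨1, ?_⟩ ⟨1, ?_⟩ fun T => ?_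
  · rintro _ ⟨T, rfl⟩
    have h1 : 0 ≤ opt D H T := Real.iInf_nonneg fun _ => herr0 _
    have h2 := herr1 (h ∘ (T : X → X))
    simp only
    linarith
  · rintro _ ⟨T, rfl⟩
    have h1 : 0 ≤ empOpt S H T := Real.iInf_nonneg fun _ => empErr_nonneg _ _
    have h2 := empErr_le_one S (h ∘ (T : X → X))
    simp only
    linarith
  · have h1 := abs_sub_le_iff.1 (hopt T T.2)
    have h2 := abs_sub_le_iff.1 (hS _ ⟨h, hh, T, T.2, rfl⟩)
    rw [abs_sub_le_iff]
    constructor <;> linarith [h1.1, h1.2, h2.1, h2.2]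

/-- Uniform convergence makes every minimizer of the empirical worst-case regret near-optimal. -/
theorem worstRegret_le_of_isRegretMinimizer (D : Measure (X × Label)) [IsProbabilityMeasure D]
    {H : Set (X → Label)} {𝒯 : Set (X → X)} (h𝒯 : 𝒯.Nonempty) {m : ℕ} {S : Fin m → X × Label}
    {η : ℝ} (hS : ∀ f ∈ compClass H 𝒯, |err D f - empErr S f| ≤ η) {h : X → Label}
    (hh : IsRegretMinimizer S H 𝒯 h) :
    worstRegret D H 𝒯 h ≤ (⨅ h' : H, worstRegret D H 𝒯 (h' : X → Label)) + 4 * η := by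
  have : Nonempty H := ⟨⟨h, hh.1⟩⟩
  rw [← sub_le_iff_le_add]
  refine le_ciInf fun h' => ?_
  have h1 := abs_sub_le_iff.1 (abs_worstRegret_sub_empWorstRegret_le D h𝒯 hS hh.1)
  have h2 := abs_sub_le_iff.1 (abs_worstRegret_sub_empWorstRegret_le D h𝒯 hS h'.2)
  linarith [h1.1, h2.2, hh.2 h' h'.2]

end Regret

end TransformationLearning

/-- The constant `C` is universal. The failure set need not be measurable, so "with probability at
least `1 - δ`" is the assertion that its outer measure is at most `δ`; the guarantee covers every
minimizer that the learning rule may output. -/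
theorem theorem5 :
    ∃ C : ℝ, 0 < C ∧
      ∀ (X : Type u) [MeasurableSpace X]
        (H : Set (X → Label)) (𝒯 : Set (X → X)), H.Nonempty → 𝒯.Nonempty →
      ∀ (d : ℕ), vcDim (compClass H 𝒯) = (d : ℕ∞) →
      ∀ (ε δ : ℝ), ε ∈ Set.Ioo (0 : ℝ) (1 / 2) → δ ∈ Set.Ioo (0 : ℝ) (1 / 2) →
      ∀ (D : Measure (X × Label)) [IsProbabilityMeasure D],
      ∀ (m : ℕ), C * (((d : ℝ) + Real.log (1 / δ)) / ε ^ 2) ≤ (m : ℝ) →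
        WellBehaved D (compClass H 𝒯) m →
        sampleLaw D m
          {S | ¬ ∀ h : X → Label, IsRegretMinimizer S H 𝒯 h →
            worstRegret D H 𝒯 h ≤ (⨅ h' : H, worstRegret D H 𝒯 (h' : X → Label)) + ε}
          ≤ ENNReal.ofReal δ := by
  -- `163840 = 64 * 2560`: uniform convergence is used with `ε / 8`, giving deviation `ε / 4` and
  -- hence excess regret `4 * (ε / 4) = ε`.
  refine ⟨163840, by norm_num, ?_⟩
  intro X _ H 𝒯 hH h𝒯 d hd ε δ hε hδ D _ m hm hwell
  obtain ⟨hε0, -⟩ := hε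
  obtain ⟨hδ0, hδ1⟩ := hδ
  have hF : (compClass H 𝒯).Nonempty := by
    obtain ⟨h, hh⟩ := hH
    obtain ⟨T, hT⟩ := h𝒯
    exact ⟨h ∘ T, h, hh, T, hT, rfl⟩
  have hm' : 2560 * (d + Real.log (1 / δ)) ≤ (ε / 8) ^ 2 * m := by
    rw [← mul_div_assoc, div_le_iff₀ (by positivity)] at hm
    linarith
  refine (measure_mono fun S hS => ?_).trans
    (measure_exists_abs_err_sub_empErr_gt_le D hF hd.le (by positivity) hδ0 hδ1 hm' hwell)
  by_contra hgood
  simp only [Set.mem_ofPred_eq, not_exists, not_and, not_lt] at hgood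
  refine hS fun h hh => ?_
  have h1 := worstRegret_le_of_isRegretMinimizer D h𝒯 hgood hh
  linarith
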